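/- Theorem. For every integer $n \ge 21$ there exists a polyhedral platypus of order $n$, that is, a simple graph $G$ with exactly $n$ vertices which is planar and $3$-connected, which is non-hamiltonian (it contains no spanning cycle), and for which every vertex-deleted subgraph $G - v$ is traceable (it contains a spanning path). -/

import Mathlib

namespace SimpleGraph

/-- `A` is a simple arc in the plane with end-points `x` and `y`: the image of an injective
continuous path from `x` to `y`. -/
def IsPlaneArc (A : Set (ℝ × ℝ)) (x y : ℝ × ℝ) : Prop :=
  ∃ γ : _root_.Path x y, Function.Injective γ ∧ Set.range γ = A

/-- A drawing of `G` in the plane without crossings: the vertices are distinct points, every edge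
is a simple arc between its end-vertices that contains no other vertex, and two distinct edges
meet at most in common end-vertices. (The value of `arc` at a pair that is not an edge is
irrelevant.) -/
structure PlaneEmbedding {V : Type*} (G : SimpleGraph V) where
  /-- The position of a vertex. -/
  point : V → ℝ × ℝ
  /-- The arc that represents an edge. -/
  arc : Sym2 V → Set (ℝ × ℝ)
  point_injective : Function.Injective point
  isPlaneArc : ∀ u v : V, G.Adj u v → IsPlaneArc (arc s(u, v)) (point u) (point v)
  mem_of_point_mem : ∀ e ∈ G.edgeSet, ∀ w : V, point w ∈ arc e → w ∈ e
  inter_subset : ∀ e ∈ G.edgeSet, ∀ f ∈ G.edgeSet, e ≠ f →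
    ∀ x ∈ arc e ∩ arc f, ∃ w : V, w ∈ e ∧ w ∈ f ∧ x = point w

/-- A graph is planar if it can be drawn in the plane without crossings. -/
def IsPlanar {V : Type*} (G : SimpleGraph V) : Prop :=
  Nonempty (PlaneEmbedding G)

/-- `G` is `k`-connected: it has more than `k` vertices, and it stays connected whenever fewer
than `k` vertices are deleted. -/
def IsKConnected {V : Type*} [Fintype V] (G : SimpleGraph V) (k : ℕ) : Prop :=
  k < Fintype.card V ∧
    ∀ S : Finset V, S.card < k → (G.induce ((S : Set V)ᶜ)).Connected

/-- A graph is polyhedral if it is planar and 3-connected. -/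
def IsPolyhedral {V : Type*} [Fintype V] (G : SimpleGraph V) : Prop :=
  G.IsPlanar ∧ G.IsKConnected 3

/-- A graph is traceable if it has a hamiltonian path. -/
def IsTraceable {V : Type*} [DecidableEq V] (G : SimpleGraph V) : Prop :=
  ∃ (a b : V) (p : G.Walk a b), p.IsHamiltonian

/-- A platypus: a non-hamiltonian graph on at least three vertices all of whose vertex-deleted
subgraphs are traceable. -/
def IsPlatypus {V : Type*} [Fintype V] [DecidableEq V] (G : SimpleGraph V) : Prop :=
  3 ≤ Fintype.card V ∧ ¬ G.IsHamiltonian ∧ ∀ v : V, (G.induce ({v}ᶜ : Set V)).IsTraceable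

end SimpleGraph

/-! For n = 21 the vertex 20 is cubic with neighbours 17, 18, 19. For larger n it is replaced by a
path, the rim, that leads from 17 to 19 and is joined in all its vertices to the hub 18. The rest of
the graph, the core, does not depend on n, so every claim reduces to a finite check on at most 21
vertices and an argument about the fan.

Planarity: in a straight-line drawing any two edges are separated by a line
(`isPlanar_of_separated`). Core edges have integral certificates; the rim lies on a parabola, where
convexity gives the lines for every n.

Non-hamiltonicity: contracting the rim to 20 turns a spanning cycle into a connected edge set on 21
vertices with degree 2 at each core vertex, except that the hub may have degree 1, since two of its
cycle edges can merge. Nothing is demanded of the degree of 20, so one exhaustive search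
(`searchFails_contractedEdges`) serves all n.

Deleted subgraphs are traced by explicit core paths with the rim spliced in. For 3-connectedness, a
property constant along the edges that avoid two vertices is shown to be constant
(`exists_iff_of_fanAdj`). -/

namespace SimpleGraph

/-! ### The graphs. -/

/-- The edges of the fan graph outside the rim. -/
def coreEdges : List (ℕ × ℕ) :=
  [(0, 2), (0, 8), (0, 16), (1, 8), (5, 8), (1, 7), (1, 16), (6, 16), (5, 7), (6, 7), (5, 10),
    (5, 14), (4, 6), (6, 13), (4, 14), (4, 15), (9, 14), (9, 15), (9, 17), (12, 15), (2, 10),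
    (10, 17), (2, 13), (2, 19), (12, 13), (3, 12), (11, 12), (3, 18), (3, 19), (11, 17),
    (11, 18), (18, 19)]

/-- Adjacency, in one direction, of the fan graph of order `n`: the vertices `20, …, n - 1` form
a path from a neighbour of `17` to a neighbour of `19`, and all of them are joined to `18`. -/
def FanRel (n a b : ℕ) : Prop :=
  (a, b) ∈ coreEdges ∨ (a = 17 ∧ b = 20) ∨ (a = 18 ∧ 20 ≤ b) ∨ (20 ≤ a ∧ b = a + 1) ∨
    (20 ≤ a ∧ a + 1 = n ∧ b = 19)

/-- The fan graph of order `n`. -/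
def fanGraph (n : ℕ) : SimpleGraph (Fin n) := fromRel fun a b ↦ FanRel n a b

theorem lt_of_mem_coreEdges {a b : ℕ} (h : (a, b) ∈ coreEdges) : a < b ∧ b < 20 := by
  have : ∀ e ∈ coreEdges, e.1 < e.2 ∧ e.2 < 20 := by decide
  exact this _ h

theorem FanRel.ne {n a b : ℕ} (h : FanRel n a b) : a ≠ b := by
  rcases h with h | h | h | h | h
  · exact (lt_of_mem_coreEdges h).1.ne
  all_goals omega

theorem fanGraph_adj {n : ℕ} {a b : Fin n} :
    (fanGraph n).Adj a b ↔ FanRel n a b ∨ FanRel n b a := by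
  rw [fanGraph, fromRel_adj, and_iff_right_iff_imp]
  rintro (h | h) rfl <;> exact h.ne rfl

/-! ### Separating lines and straight-line drawings. -/

/-- The value at `p` of the affine function with coefficients `α`, `β`, `γ`. -/
def affineEval (α β γ : ℝ) (p : ℝ × ℝ) : ℝ := α * p.1 + β * p.2 + γ

/-- A line separates the segment `P a P b` from the segment `P c P d`, except that a common
end-vertex may lie on it. -/
def Separated (P : ℕ → ℝ × ℝ) (a b c d : ℕ) : Prop :=
  ∃ α β γ : ℝ, 0 ≤ affineEval α β γ (P a) ∧ 0 ≤ affineEval α β γ (P b) ∧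
    (affineEval α β γ (P c) < 0 ∨ affineEval α β γ (P c) ≤ 0 ∧ (c = a ∨ c = b)) ∧
    (affineEval α β γ (P d) < 0 ∨ affineEval α β γ (P d) ≤ 0 ∧ (d = a ∨ d = b))

theorem Separated.swap_left {P : ℕ → ℝ × ℝ} {a b c d : ℕ} (h : Separated P a b c d) :
    Separated P b a c d := by
  obtain ⟨α, β, γ, ha, hb, hc, hd⟩ := h
  exact ⟨α, β, γ, hb, ha, by tauto, by tauto⟩

theorem Separated.swap_right {P : ℕ → ℝ × ℝ} {a b c d : ℕ} (h : Separated P a b c d) :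
    Separated P a b d c := by
  obtain ⟨α, β, γ, ha, hb, hc, hd⟩ := h
  exact ⟨α, β, γ, ha, hb, hd, hc⟩

theorem affineEval_combo (α β γ : ℝ) {s t : ℝ} (hst : s + t = 1) (p q : ℝ × ℝ) :
    affineEval α β γ (s • p + t • q) = s * affineEval α β γ p + t * affineEval α β γ q := by
  simp only [affineEval, Prod.fst_add, Prod.snd_add, Prod.smul_fst, Prod.smul_snd, smul_eq_mul]
  linear_combination (-γ) * hst

/-- At a common point the affine function is both non-negative and non-positive, so an end of the
second segment with negative value has weight 0 there. If neither end is negative, both are ends of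
the first edge, and the edges coincide. -/
theorem Separated.exists_common {P : ℕ → ℝ × ℝ} {a b c d : ℕ} (h : Separated P a b c d)
    (hcd : c ≠ d) (hne : s(a, b) ≠ s(c, d)) {x : ℝ × ℝ} (hx : x ∈ segment ℝ (P a) (P b))
    (hx' : x ∈ segment ℝ (P c) (P d)) : ∃ w, (w = a ∨ w = b) ∧ (w = c ∨ w = d) ∧ x = P w := by
  obtain ⟨α, β, γ, ha, hb, hc, hd⟩ := h
  obtain ⟨s, t, hs, ht, hst, rfl⟩ := hx
  obtain ⟨s', t', hs', ht', hst', hxx⟩ := hx'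
  have h1 := affineEval_combo α β γ hst (P a) (P b)
  have h2 := affineEval_combo α β γ hst' (P c) (P d)
  rw [hxx] at h2
  have h0 : 0 ≤ affineEval α β γ (s • P a + t • P b) := by rw [h1]; positivity
  rw [h2] at h0
  rcases hc with hc | ⟨hc, hc'⟩ <;> rcases hd with hd | ⟨hd, hd'⟩
  · rcases hs'.eq_or_lt with h | h
    · have ht1 : t' = 1 := by linarith
      rw [← h, ht1] at h0
      linarith
    · nlinarith [mul_neg_of_pos_of_neg h hc, mul_nonpos_of_nonneg_of_nonpos ht' hd.le]
  · have : s' = 0 := by nlinarith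
    have ht1 : t' = 1 := by linarith
    refine ⟨d, hd', Or.inr rfl, ?_⟩
    rw [← hxx, this, ht1]; simp
  · have : t' = 0 := by nlinarith
    have hs1 : s' = 1 := by linarith
    refine ⟨c, hc', Or.inl rfl, ?_⟩
    rw [← hxx, this, hs1]; simp
  · exfalso
    apply hne
    rw [Sym2.eq_iff]
    omega

theorem isPlaneArc_segment {x y : ℝ × ℝ} (h : x ≠ y) : IsPlaneArc (segment ℝ x y) x y := by
  refine ⟨⟨⟨fun t ↦ AffineMap.lineMap x y (t : ℝ), ?_⟩, by simp, by simp⟩, ?_, ?_⟩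
  · exact AffineMap.lineMap_continuous.comp continuous_subtype_val
  · intro s t hst
    exact Subtype.ext (AffineMap.lineMap_injective ℝ h hst)
  · rw [segment_eq_image_lineMap]
    ext z
    constructor
    · rintro ⟨t, rfl⟩
      exact ⟨t, t.2, rfl⟩
    · rintro ⟨t, ht, rfl⟩
      exact ⟨⟨t, ht⟩, rfl⟩

/-- A straight-line drawing in which any two edges are separated by lines shows planarity. -/
theorem isPlanar_of_separated {n : ℕ} {G : SimpleGraph (Fin n)} (P : ℕ → ℝ × ℝ)
    (hP : ∀ a < n, ∀ b < n, P a = P b → a = b) (hdeg : ∀ v, ∃ w, G.Adj v w)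
    (hsep : ∀ a b c d : Fin n, G.Adj a b → G.Adj c d → s((a : ℕ), (b : ℕ)) ≠ s((c : ℕ), (d : ℕ)) →
      Separated P a b c d ∨ Separated P c d a b) : G.IsPlanar := by
  have key : ∀ a b c d : Fin n, G.Adj a b → G.Adj c d → s(a, b) ≠ s(c, d) →
      ∀ x ∈ segment ℝ (P a) (P b) ∩ segment ℝ (P c) (P d),
        ∃ w, w ∈ s(a, b) ∧ w ∈ s(c, d) ∧ x = P w := by
    rintro a b c d hab hcd hne x ⟨hx, hx'⟩
    have hne' : s((a : ℕ), (b : ℕ)) ≠ s((c : ℕ), (d : ℕ)) := by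
      intro h
      apply hne
      rw [Sym2.eq_iff] at h ⊢
      simpa [Fin.ext_iff] using h
    have hab' : (a : ℕ) ≠ b := fun h ↦ hab.ne (Fin.ext h)
    have hcd' : (c : ℕ) ≠ d := fun h ↦ hcd.ne (Fin.ext h)
    obtain ⟨w, hw, hw', rfl⟩ : ∃ w, (w = (a : ℕ) ∨ w = b) ∧ (w = (c : ℕ) ∨ w = d) ∧ x = P w := by
      rcases hsep a b c d hab hcd hne' with h | h
      · exact h.exists_common hcd' hne' hx hx'
      · obtain ⟨w, h1, h2, h3⟩ := h.exists_common hab' hne'.symm hx' hx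
        exact ⟨w, h2, h1, h3⟩
    rcases hw with rfl | rfl
    · exact ⟨a, by simp, by simpa [Fin.ext_iff] using hw', rfl⟩
    · exact ⟨b, by simp, by simpa [Fin.ext_iff] using hw', rfl⟩
  have inj : Function.Injective fun v : Fin n ↦ P v :=
    fun a b h ↦ Fin.ext (hP a a.2 b b.2 h)
  let arc : Sym2 (Fin n) → Set (ℝ × ℝ) :=
    Sym2.lift ⟨fun a b ↦ segment ℝ (P a) (P b), fun a b ↦ segment_symm ℝ _ _⟩
  have inter : ∀ e ∈ G.edgeSet, ∀ f ∈ G.edgeSet, e ≠ f →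
      ∀ x ∈ arc e ∩ arc f, ∃ w : Fin n, w ∈ e ∧ w ∈ f ∧ x = P w := by
    intro e
    induction e with | _ a b
    intro he f
    induction f with | _ c d
    intro hf hne x hx
    exact key a b c d he hf hne x hx
  refine ⟨⟨fun v ↦ P v, arc, inj, fun u v huv ↦ ?_, fun e he w hw ↦ ?_, inter⟩⟩
  · exact isPlaneArc_segment fun h ↦ huv.ne (inj h)
  -- A vertex on a foreign arc would be a point shared with an edge at that vertex, hence a common
  -- end-vertex.
  · by_contra hwe
    obtain ⟨z, hz⟩ := hdeg w
    obtain ⟨y, hy, -, hyw⟩ := inter e he s(w, z) hz (fun h ↦ hwe (h ▸ Sym2.mem_mk_left w z)) _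
      ⟨hw, left_mem_segment ℝ _ _⟩
    exact hwe (inj hyw ▸ hy)

/-! ### Integral certificates for the drawing of the core. -/

/-- The positions of the vertices outside the rim. -/
def corePoints : List (ℤ × ℤ) :=
  [(-16, -35), (-16, -26), (-17, -43), (9, 46), (-11, -4), (-10, -15), (-18, -24), (-17, -23),
    (-14, -29), (-6, 9), (-7, -10), (-3, 13), (-6, 28), (-22, -27), (-9, -3), (-7, 16),
    (-17, -26), (-2, 2), (0, 8), (2, 2)]

/-- The position of a vertex outside the rim. -/
def corePoint (v : ℕ) : ℤ × ℤ := corePoints.getD v (0, 0)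

/-- For each edge outside the rim, a line that separates it from the fan. -/
def coreSeparators : List ((ℕ × ℕ) × (ℤ × ℤ × ℤ)) :=
  [((0, 2), -1, -1, -51), ((0, 8), -1, -1, -43), ((0, 16), -1, -1, -43), ((1, 7), -1, -1, -40),
    ((1, 8), -1, -1, -42), ((1, 16), -1, -1, -42), ((2, 10), -1, -1, -17), ((2, 13), -1, -1, -49),
    ((2, 19), 7, -3, -8), ((3, 12), -1, 1, -34), ((3, 18), -1, 1, -8), ((3, 19), 1, 0, -2),
    ((4, 6), -1, -1, -15), ((4, 14), -1, -1, -12), ((4, 15), -1, 0, -7), ((5, 7), -1, -1, -25),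
    ((5, 8), -1, -1, -25), ((5, 10), -1, -1, -17), ((5, 14), -1, -1, -12), ((6, 7), -1, -1, -40),
    ((6, 13), -1, -1, -42), ((6, 16), -1, -1, -42), ((9, 14), -1, 0, -6), ((9, 15), -1, 0, -6),
    ((9, 17), -1, 0, -2), ((10, 17), -1, 0, -2), ((11, 12), -1, 0, -3), ((11, 17), -1, 0, -2),
    ((11, 18), -1, 1, -8), ((12, 13), -1, 0, -6), ((12, 15), -1, 0, -6), ((18, 19), 3, 1, -8)]

/-- The integral version of `affineEval`. -/
def intEval (l : ℤ × ℤ × ℤ) (p : ℤ × ℤ) : ℤ := l.1 * p.1 + l.2.1 * p.2 + l.2.2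

/-- The line through two points of the integral grid. -/
def lineThrough (s : ℤ) (p q : ℤ × ℤ) : ℤ × ℤ × ℤ :=
  (s * (p.2 - q.2), s * (q.1 - p.1), s * (p.1 * q.2 - p.2 * q.1))

/-- The line `l` separates the edge `e` from the edge `f`. -/
def lineSeparates (l : ℤ × ℤ × ℤ) (e f : ℕ × ℕ) : Prop :=
  0 ≤ intEval l (corePoint e.1) ∧ 0 ≤ intEval l (corePoint e.2) ∧
    (intEval l (corePoint f.1) < 0 ∨
      intEval l (corePoint f.1) ≤ 0 ∧ (f.1 = e.1 ∨ f.1 = e.2)) ∧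
    (intEval l (corePoint f.2) < 0 ∨
      intEval l (corePoint f.2) ≤ 0 ∧ (f.2 = e.1 ∨ f.2 = e.2))

instance (l : ℤ × ℤ × ℤ) (e f : ℕ × ℕ) : Decidable (lineSeparates l e f) := by
  unfold lineSeparates; infer_instance

/-- The separating line can always be taken along one of the two edges; the sign `s` selects its
side. -/
theorem core_edges_separated : ∀ e ∈ coreEdges, ∀ f ∈ coreEdges, e ≠ f →
    (∃ s ∈ [(1 : ℤ), -1], lineSeparates (lineThrough s (corePoint e.1) (corePoint e.2)) e f) ∨
    ∃ s ∈ [(1 : ℤ), -1], lineSeparates (lineThrough s (corePoint f.1) (corePoint f.2)) f e := by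
  decide +kernel

/-- The line `l` has the edge `e` on its non-negative side, and the fan, with the exception of
end-vertices of `e`, on its negative side. -/
def lineAvoidsFan (l : ℤ × ℤ × ℤ) (e : ℕ × ℕ) : Prop :=
  0 ≤ intEval l (corePoint e.1) ∧ 0 ≤ intEval l (corePoint e.2) ∧ intEval l (0, -2) < 0 ∧
    ∀ v ∈ [17, 18, 19], intEval l (corePoint v) < 0 ∨
      intEval l (corePoint v) ≤ 0 ∧ (v = e.1 ∨ v = e.2)

instance (l : ℤ × ℤ × ℤ) (e : ℕ × ℕ) : Decidable (lineAvoidsFan l e) := by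
  unfold lineAvoidsFan; infer_instance

/-- The point (0, -2) in `lineAvoidsFan` is where the tangents to the rim parabola at 17 and 19
meet; with 17 and 19 it spans a triangle that contains the rim. -/
theorem exists_lineAvoidsFan : ∀ e ∈ coreEdges, ∃ p ∈ coreSeparators, lineAvoidsFan p.2 e := by
  decide +kernel

theorem corePoint_injOn : ∀ a < 20, ∀ b < 20, corePoint a = corePoint b → a = b := by
  decide +kernel

/-! ### The rim on a parabola, and planarity. -/

/-- A parabola through the positions of `17` and `19`. -/
def rimPoint (t : ℝ) : ℝ × ℝ := (2 * t, 2 * t ^ 2)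

/-- The parameter on the parabola of the `j`-th vertex of the path from `17` to `19` that runs
along the rim. -/
noncomputable def rimParameter (n j : ℕ) : ℝ := 2 * j / (n - 19) - 1

/-- The positions of all vertices. -/
noncomputable def fanPoint (n v : ℕ) : ℝ × ℝ :=
  if v < 20 then ((corePoint v).1, (corePoint v).2) else rimPoint (rimParameter n (v - 19))

/-- The `j`-th vertex of the path from `17` to `19` that runs along the rim. -/
def rimVertex (n j : ℕ) : ℕ := if j = 0 then 17 else if j = n - 19 then 19 else 19 + j

theorem fanPoint_of_lt {n v : ℕ} (hv : v < 20) :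
    fanPoint n v = (((corePoint v).1 : ℝ), ((corePoint v).2 : ℝ)) := if_pos hv

theorem fanPoint_hub (n : ℕ) : fanPoint n 18 = (0, 8) := by
  rw [fanPoint_of_lt (by norm_num)]
  norm_num [corePoint, corePoints]

theorem fanPoint_rimVertex {n j : ℕ} (hn : 21 ≤ n) (hj : j ≤ n - 19) :
    fanPoint n (rimVertex n j) = rimPoint (rimParameter n j) := by
  have h0 : ((n : ℝ) - 19) ≠ 0 := by
    have : (21 : ℝ) ≤ n := by exact_mod_cast hn
    linarith
  unfold rimVertex
  split_ifs with h1 h2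
  · subst h1
    norm_num [fanPoint, corePoint, corePoints, rimPoint, rimParameter]
  · subst h2
    have : ((n - 19 : ℕ) : ℝ) = n - 19 := by push_cast [show 19 ≤ n by omega]; ring
    rw [rimParameter, this, mul_div_assoc, div_self h0]
    norm_num [fanPoint, corePoint, corePoints, rimPoint]
  · rw [fanPoint, if_neg (by omega), Nat.add_sub_cancel_left]

theorem rimParameter_lt {n j k : ℕ} (hn : 21 ≤ n) (h : j < k) :
    rimParameter n j < rimParameter n k := by
  have h0 : (0 : ℝ) < n - 19 := by
    have : (21 : ℝ) ≤ n := by exact_mod_cast hn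
    linarith
  have : (j : ℝ) < k := by exact_mod_cast h
  unfold rimParameter
  gcongr

theorem rimParameter_zero (n : ℕ) : rimParameter n 0 = -1 := by simp [rimParameter]

theorem rimParameter_last {n : ℕ} (hn : 21 ≤ n) : rimParameter n (n - 19) = 1 := by
  have h0 : ((n : ℝ) - 19) ≠ 0 := by
    have : (21 : ℝ) ≤ n := by exact_mod_cast hn
    linarith
  have : ((n - 19 : ℕ) : ℝ) = n - 19 := by push_cast [show 19 ≤ n by omega]; ring
  rw [rimParameter, this, mul_div_assoc, div_self h0]
  norm_num

theorem neg_one_le_rimParameter {n : ℕ} (hn : 21 ≤ n) (j : ℕ) : -1 ≤ rimParameter n j := by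
  rcases j.eq_zero_or_pos with rfl | h
  · exact (rimParameter_zero n).ge
  · exact (rimParameter_zero n).symm.le.trans (rimParameter_lt hn h).le

theorem rimParameter_le_one {n j : ℕ} (hn : 21 ≤ n) (hj : j ≤ n - 19) : rimParameter n j ≤ 1 := by
  rcases hj.eq_or_lt with rfl | h
  · exact (rimParameter_last hn).le
  · exact (rimParameter_lt hn h).le.trans (rimParameter_last hn).le

/-- The position of a vertex strictly inside the rim. -/
theorem fanPoint_rim {n v : ℕ} (hn : 21 ≤ n) (hv : 20 ≤ v) (hvn : v < n) :
    ∃ t, -1 < t ∧ t < 1 ∧ fanPoint n v = rimPoint t := by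
  refine ⟨rimParameter n (v - 19), ?_, ?_, if_neg (by omega)⟩
  · rw [← rimParameter_zero n]
    exact rimParameter_lt hn (by omega)
  · rw [← rimParameter_last hn]
    exact rimParameter_lt hn (by omega)

theorem affineEval_fanPoint {n v : ℕ} (l : ℤ × ℤ × ℤ) (hv : v < 20) :
    affineEval l.1 l.2.1 l.2.2 (fanPoint n v) = (intEval l (corePoint v) : ℤ) := by
  rw [fanPoint_of_lt hv]
  simp [affineEval, intEval]

theorem lineSeparates.separated {n : ℕ} {l : ℤ × ℤ × ℤ} {e f : ℕ × ℕ} (h : lineSeparates l e f)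
    (he : e.1 < 20 ∧ e.2 < 20) (hf : f.1 < 20 ∧ f.2 < 20) :
    Separated (fanPoint n) e.1 e.2 f.1 f.2 := by
  refine ⟨l.1, l.2.1, l.2.2, ?_⟩
  rw [affineEval_fanPoint l he.1, affineEval_fanPoint l he.2, affineEval_fanPoint l hf.1,
    affineEval_fanPoint l hf.2]
  exact_mod_cast h

theorem core_core_separated {n : ℕ} {e f : ℕ × ℕ} (he : e ∈ coreEdges) (hf : f ∈ coreEdges)
    (hne : e ≠ f) :
    Separated (fanPoint n) e.1 e.2 f.1 f.2 ∨ Separated (fanPoint n) f.1 f.2 e.1 e.2 := by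
  have he' := lt_of_mem_coreEdges (a := e.1) (b := e.2) he
  have hf' := lt_of_mem_coreEdges (a := f.1) (b := f.2) hf
  rcases core_edges_separated e he f hf hne with ⟨s, -, h⟩ | ⟨s, -, h⟩
  · exact Or.inl (h.separated (by omega) (by omega))
  · exact Or.inr (h.separated (by omega) (by omega))

theorem core_fan_separated {n : ℕ} (hn : 21 ≤ n) {e : ℕ × ℕ} (he : e ∈ coreEdges) {c d : ℕ}
    (hc : 17 ≤ c ∧ c < n) (hd : 17 ≤ d ∧ d < n) : Separated (fanPoint n) e.1 e.2 c d := by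
  have he' := lt_of_mem_coreEdges (a := e.1) (b := e.2) he
  obtain ⟨⟨e', l⟩, _, h1, h2, h3, h4⟩ := exists_lineAvoidsFan e he
  dsimp only at h1 h2 h3 h4
  have key : ∀ v, 17 ≤ v → v < n → affineEval l.1 l.2.1 l.2.2 (fanPoint n v) < 0 ∨
      affineEval l.1 l.2.1 l.2.2 (fanPoint n v) ≤ 0 ∧ (v = e.1 ∨ v = e.2) := by
    intro v hv hvn
    rcases lt_or_ge v 20 with hv' | hv'
    · rw [affineEval_fanPoint l hv']
      exact_mod_cast h4 v (by
        rw [List.mem_cons, List.mem_cons, List.mem_singleton]; omega)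
    · left
      obtain ⟨t, ht, ht', hp⟩ := fanPoint_rim hn hv' hvn
      have hl : affineEval l.1 l.2.1 l.2.2 (-2, 2) ≤ 0 := by
        have := h4 17 (by simp)
        have h : intEval l (corePoint 17) ≤ 0 := by omega
        have := affineEval_fanPoint (n := n) l (v := 17) (by norm_num)
        rw [show fanPoint n 17 = (-2, 2) by norm_num [fanPoint, corePoint, corePoints]] at this
        rw [this]
        exact_mod_cast h
      have hr : affineEval l.1 l.2.1 l.2.2 (2, 2) ≤ 0 := by
        have := h4 19 (by simp)
        have h : intEval l (corePoint 19) ≤ 0 := by omega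
        have := affineEval_fanPoint (n := n) l (v := 19) (by norm_num)
        rw [show fanPoint n 19 = (2, 2) by norm_num [fanPoint, corePoint, corePoints]] at this
        rw [this]
        exact_mod_cast h
      have ha : affineEval l.1 l.2.1 l.2.2 (0, -2) < 0 := by
        have : affineEval l.1 l.2.1 l.2.2 (0, -2) = (intEval l (0, -2) : ℤ) := by
          simp [affineEval, intEval]
        rw [this]
        exact_mod_cast h3
      rw [hp]
      have : affineEval l.1 l.2.1 l.2.2 (rimPoint t) =
          (1 - t) ^ 2 / 4 * affineEval l.1 l.2.1 l.2.2 (-2, 2) +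
          (1 + t) ^ 2 / 4 * affineEval l.1 l.2.1 l.2.2 (2, 2) +
          (1 - t ^ 2) / 2 * affineEval l.1 l.2.1 l.2.2 (0, -2) := by
        simp only [affineEval, rimPoint]
        ring
      rw [this]
      have hpos : 0 < (1 - t ^ 2) / 2 := by nlinarith
      have i1 := mul_neg_of_pos_of_neg hpos ha
      have i2 := mul_nonpos_of_nonneg_of_nonpos (show 0 ≤ (1 - t) ^ 2 / 4 by positivity) hl
      have i3 := mul_nonpos_of_nonneg_of_nonpos (show 0 ≤ (1 + t) ^ 2 / 4 by positivity) hr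
      linarith
  refine ⟨l.1, l.2.1, l.2.2, ?_, ?_, key c hc.1 hc.2, key d hd.1 hd.2⟩
  · rw [affineEval_fanPoint l (by omega)]
    exact_mod_cast h1
  · rw [affineEval_fanPoint l (by omega)]
    exact_mod_cast h2

/-- The coefficients are those of the chord through the points with parameters x and y. The factored
value is negative for z outside [x, y], so a chord between consecutive rim vertices has the
remaining ones strictly on one side. The hub is on that side too, as |xy| ≤ 1. -/
theorem affineEval_chord (x y z : ℝ) :
    affineEval (x + y) (-1) (-(2 * x * y)) (rimPoint z) = -(2 * ((z - x) * (z - y))) := by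
  simp only [affineEval, rimPoint]
  ring

theorem affineEval_chord_hub (x y : ℝ) :
    affineEval (x + y) (-1) (-(2 * x * y)) (0, 8) = -8 - 2 * x * y := by
  simp only [affineEval]
  ring

theorem rim_rim_separated {n j k : ℕ} (hn : 21 ≤ n) (hjk : j < k) (hk : k < n - 19) :
    Separated (fanPoint n) (rimVertex n j) (rimVertex n (j + 1)) (rimVertex n k)
      (rimVertex n (k + 1)) := by
  refine ⟨rimParameter n j + rimParameter n (j + 1), -1,
    -(2 * rimParameter n j * rimParameter n (j + 1)), ?_, ?_, ?_⟩
  all_goals simp only [fanPoint_rimVertex hn (show j ≤ n - 19 by omega),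
    fanPoint_rimVertex hn (show j + 1 ≤ n - 19 by omega),
    fanPoint_rimVertex hn (show k ≤ n - 19 by omega),
    fanPoint_rimVertex hn (show k + 1 ≤ n - 19 by omega), affineEval_chord]
  · simp
  · simp
  · have h1 := rimParameter_lt hn (show j < j + 1 by omega)
    have h2 := rimParameter_lt hn (show j + 1 < k + 1 by omega)
    constructor
    · rcases (show j + 1 = k ∨ j + 1 < k by omega) with rfl | h
      · right; simp
      · left
        have h3 := rimParameter_lt hn h
        nlinarith [mul_pos (sub_pos.2 (h1.trans h3)) (sub_pos.2 h3)]
    · left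
      nlinarith [mul_pos (sub_pos.2 (h1.trans h2)) (sub_pos.2 h2)]

theorem rim_spoke_separated {n j k : ℕ} (hn : 21 ≤ n) (hj : j < n - 19) (hk : k ≤ n - 19) :
    Separated (fanPoint n) (rimVertex n j) (rimVertex n (j + 1)) 18 (rimVertex n k) := by
  refine ⟨rimParameter n j + rimParameter n (j + 1), -1,
    -(2 * rimParameter n j * rimParameter n (j + 1)), ?_, ?_, ?_⟩
  all_goals simp only [fanPoint_rimVertex hn (show j ≤ n - 19 by omega),
    fanPoint_rimVertex hn (show j + 1 ≤ n - 19 by omega), fanPoint_rimVertex hn hk,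
    affineEval_chord, fanPoint_hub, affineEval_chord_hub]
  · simp
  · simp
  · have h1 := rimParameter_lt hn (show j < j + 1 by omega)
    constructor
    · left
      nlinarith [neg_one_le_rimParameter hn j, neg_one_le_rimParameter hn (j + 1),
        rimParameter_le_one hn (show j ≤ n - 19 by omega),
        rimParameter_le_one hn (show j + 1 ≤ n - 19 by omega)]
    · rcases (show k = j ∨ k = j + 1 ∨ k < j ∨ j + 1 < k by omega) with rfl | rfl | h | h
      · right; simp
      · right; simp
      · left
        have h3 := rimParameter_lt hn h
        nlinarith [mul_pos (sub_pos.2 h3) (sub_pos.2 (h3.trans h1))]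
      · left
        have h3 := rimParameter_lt hn h
        nlinarith [mul_pos (sub_pos.2 h3) (sub_pos.2 (h1.trans h3))]

theorem spoke_spoke_separated {n j k : ℕ} (hn : 21 ≤ n) (hj : j ≤ n - 19) (hk : k ≤ n - 19)
    (hjk : j ≠ k) : Separated (fanPoint n) 18 (rimVertex n j) 18 (rimVertex n k) := by
  -- The line through the hub and the rim point with parameter x; the sign of s is chosen below so
  -- that the other spoke lies on the negative side.
  have hub : ∀ s x : ℝ,
      affineEval (s * (8 - 2 * x ^ 2)) (s * (2 * x)) (-(s * (16 * x))) (0, 8) = 0 := by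
    intro s x
    simp only [affineEval]
    ring
  have rim : ∀ s x z : ℝ,
      affineEval (s * (8 - 2 * x ^ 2)) (s * (2 * x)) (-(s * (16 * x))) (rimPoint z) =
        s * (4 * ((z - x) * (4 + x * z))) := by
    intro s x z
    simp only [affineEval, rimPoint]
    ring
  have hpos : 0 < 4 + rimParameter n j * rimParameter n k := by
    nlinarith [neg_one_le_rimParameter hn j, neg_one_le_rimParameter hn k,
      rimParameter_le_one hn hj, rimParameter_le_one hn hk]
  obtain ⟨s, hs⟩ : ∃ s : ℝ, s * (4 * ((rimParameter n k - rimParameter n j) *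
      (4 + rimParameter n j * rimParameter n k))) < 0 := by
    rcases hjk.lt_or_gt with h | h
    · exact ⟨-1, by nlinarith [mul_pos (sub_pos.2 (rimParameter_lt hn h)) hpos]⟩
    · exact ⟨1, by nlinarith [mul_pos (sub_pos.2 (rimParameter_lt hn h)) hpos]⟩
  refine ⟨s * (8 - 2 * rimParameter n j ^ 2), s * (2 * rimParameter n j),
    -(s * (16 * rimParameter n j)), ?_⟩
  rw [fanPoint_hub, fanPoint_rimVertex hn hj, fanPoint_rimVertex hn hk, hub, rim, rim]
  refine ⟨le_rfl, by simp, Or.inr ⟨le_rfl, Or.inl rfl⟩, Or.inl hs⟩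

/-- Spokes have 0 < j < n - 19 because 17 is not adjacent to 18, and the edge between 18 and 19
counts as a core edge. -/
theorem FanRel.cases {n a b : ℕ} (hn : 21 ≤ n) (hb : b < n) (h : FanRel n a b) :
    (a, b) ∈ coreEdges ∨ (∃ j < n - 19, a = rimVertex n j ∧ b = rimVertex n (j + 1)) ∨
      ∃ j < n - 19, 0 < j ∧ a = 18 ∧ b = rimVertex n j := by
  rcases h with h | ⟨rfl, rfl⟩ | ⟨rfl, h⟩ | ⟨h, rfl⟩ | ⟨h, h', rfl⟩
  · exact Or.inl h
  · refine Or.inr (Or.inl ⟨0, by omega, ?_⟩)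
    unfold rimVertex
    constructor <;> split_ifs <;> first | omega | contradiction
  · refine Or.inr (Or.inr ⟨b - 19, by omega, by omega, rfl, ?_⟩)
    unfold rimVertex
    split_ifs <;> omega
  · refine Or.inr (Or.inl ⟨a - 19, by omega, ?_⟩)
    unfold rimVertex
    constructor <;> split_ifs <;> first | omega | contradiction
  · refine Or.inr (Or.inl ⟨a - 19, by omega, ?_⟩)
    unfold rimVertex
    constructor <;> split_ifs <;> first | omega | contradiction

theorem rimVertex_mem {n j : ℕ} (hn : 21 ≤ n) (hj : j ≤ n - 19) :
    17 ≤ rimVertex n j ∧ rimVertex n j < n := by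
  unfold rimVertex
  split_ifs <;> omega

theorem FanRel.separated {n a b c d : ℕ} (hn : 21 ≤ n) (hb : b < n) (hd : d < n)
    (h : FanRel n a b) (h' : FanRel n c d) (hne : s(a, b) ≠ s(c, d)) :
    Separated (fanPoint n) a b c d ∨ Separated (fanPoint n) c d a b := by
  rcases h.cases hn hb with h | ⟨j, hj, rfl, rfl⟩ | ⟨j, hj, hj0, rfl, rfl⟩ <;>
    rcases h'.cases hn hd with h' | ⟨k, hk, rfl, rfl⟩ | ⟨k, hk, hk0, rfl, rfl⟩
  · refine core_core_separated h h' fun h ↦ hne ?_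
    rw [Prod.mk.injEq] at h
    rw [h.1, h.2]
  · exact Or.inl (core_fan_separated hn h (rimVertex_mem hn hk.le) (rimVertex_mem hn hk))
  · exact Or.inl (core_fan_separated hn h (by omega) (rimVertex_mem hn hk.le))
  · exact Or.inr (core_fan_separated hn h' (rimVertex_mem hn hj.le) (rimVertex_mem hn hj))
  · rcases lt_trichotomy j k with h | rfl | h
    · exact Or.inl (rim_rim_separated hn h hk)
    · exact absurd rfl hne
    · exact Or.inr (rim_rim_separated hn h hj)
  · exact Or.inl (rim_spoke_separated hn hj hk.le)
  · exact Or.inr (core_fan_separated hn h' (by omega) (rimVertex_mem hn hj.le))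
  · exact Or.inr (rim_spoke_separated hn hk hj.le)
  · refine Or.inl (spoke_spoke_separated hn hj.le hk.le ?_)
    rintro rfl
    exact hne rfl

/-- Inner rim vertices lie in the strip |x| < 2 below height 2, whereas the only core vertex in that
strip is the hub, at height 8. -/
theorem fanPoint_core_ne_rim {n a b : ℕ} (hn : 21 ≤ n) (ha : a < 20) (hb : 20 ≤ b) (hbn : b < n) :
    fanPoint n a ≠ fanPoint n b := by
  obtain ⟨t, ht, ht', h⟩ := fanPoint_rim hn hb hbn
  rw [h, fanPoint_of_lt ha]
  intro h
  rw [rimPoint, Prod.mk.injEq] at h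
  have h1 : (-2 : ℝ) < (corePoint a).1 := by linarith
  have h2 : ((corePoint a).1 : ℝ) < 2 := by linarith
  have h3 : ((corePoint a).2 : ℝ) < 2 := by nlinarith
  have key : ∀ a < 20, -2 < (corePoint a).1 → (corePoint a).1 < 2 → ¬ (corePoint a).2 < 2 := by
    decide +kernel
  exact key a ha (by exact_mod_cast h1) (by exact_mod_cast h2) (by exact_mod_cast h3)

theorem fanPoint_injOn {n : ℕ} (hn : 21 ≤ n) :
    ∀ a < n, ∀ b < n, fanPoint n a = fanPoint n b → a = b := by
  intro a ha b hb h
  rcases lt_or_ge a 20 with ha' | ha' <;> rcases lt_or_ge b 20 with hb' | hb'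
  · rw [fanPoint_of_lt ha', fanPoint_of_lt hb', Prod.mk.injEq] at h
    exact corePoint_injOn a ha' b hb' (Prod.ext (by exact_mod_cast h.1) (by exact_mod_cast h.2))
  · exact absurd h (fanPoint_core_ne_rim hn ha' hb' hb)
  · exact absurd h.symm (fanPoint_core_ne_rim hn hb' ha' ha)
  · rw [fanPoint, fanPoint, if_neg (by omega), if_neg (by omega), rimPoint, rimPoint,
      Prod.mk.injEq] at h
    rcases lt_trichotomy a b with hab | hab | hab
    · have := rimParameter_lt hn (show a - 19 < b - 19 by omega)
      linarith [h.1]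
    · exact hab
    · have := rimParameter_lt hn (show b - 19 < a - 19 by omega)
      linarith [h.1]

theorem fanGraph_exists_adj {n : ℕ} (hn : 21 ≤ n) (v : Fin n) : ∃ w, (fanGraph n).Adj v w := by
  rcases lt_or_ge (v : ℕ) 20 with h | h
  · have key : ∀ v < 20, ∃ w < 20, (v, w) ∈ coreEdges ∨ (w, v) ∈ coreEdges := by decide +kernel
    obtain ⟨w, hw, hvw⟩ := key v h
    exact ⟨⟨w, by omega⟩, fanGraph_adj.2 (hvw.imp Or.inl Or.inl)⟩
  · exact ⟨⟨18, by omega⟩, fanGraph_adj.2 (Or.inr (Or.inr (Or.inr (Or.inl ⟨rfl, h⟩))))⟩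

theorem fanGraph_isPlanar {n : ℕ} (hn : 21 ≤ n) : (fanGraph n).IsPlanar := by
  refine isPlanar_of_separated (fanPoint n) (fanPoint_injOn hn) (fanGraph_exists_adj hn) ?_
  intro a b c d hab hcd hne
  rw [fanGraph_adj] at hab hcd
  rcases hab with h | h <;> rcases hcd with h' | h'
  · exact h.separated hn b.2 d.2 h' hne
  · exact (h.separated hn b.2 c.2 h' (by rwa [Sym2.eq_swap (a := (d : ℕ)) (b := (c : ℕ))])).imp
      (·.swap_right) (·.swap_left)
  · exact (h.separated hn a.2 d.2 h' (by rwa [Sym2.eq_swap (a := (b : ℕ)) (b := (a : ℕ))])).imp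
      (·.swap_left) (·.swap_right)
  · refine (h.separated hn a.2 c.2 h' ?_).imp (·.swap_left.swap_right) (·.swap_left.swap_right)
    rwa [Sym2.eq_swap (a := (b : ℕ)) (b := (a : ℕ)), Sym2.eq_swap (a := (d : ℕ)) (b := (c : ℕ))]

/-! ### Spanning paths of the vertex-deleted subgraphs. -/

/-- Adjacency in the fan graph, as a relation on labels. -/
def FanAdj (n a b : ℕ) : Prop := FanRel n a b ∨ FanRel n b a

/-- Adjacency outside the rim. -/
def CoreAdj (a b : ℕ) : Prop := (a, b) ∈ coreEdges ∨ (b, a) ∈ coreEdges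

instance (a b : ℕ) : Decidable (CoreAdj a b) := by unfold CoreAdj; infer_instance

theorem CoreAdj.fanAdj {n a b : ℕ} (h : CoreAdj a b) : FanAdj n a b := h.imp Or.inl Or.inl

theorem FanAdj.symm {n a b : ℕ} (h : FanAdj n a b) : FanAdj n b a := Or.symm h

theorem fanAdj_first (n : ℕ) : FanAdj n 17 20 := Or.inl (Or.inr (Or.inl ⟨rfl, rfl⟩))

theorem fanAdj_hub {n a : ℕ} (h : 20 ≤ a) : FanAdj n 18 a :=
  Or.inl (Or.inr (Or.inr (Or.inl ⟨rfl, h⟩)))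

theorem fanAdj_succ {n a : ℕ} (h : 20 ≤ a) : FanAdj n a (a + 1) :=
  Or.inl (Or.inr (Or.inr (Or.inr (Or.inl ⟨h, rfl⟩))))

theorem fanAdj_last {n a : ℕ} (h : 20 ≤ a) (h' : a + 1 = n) : FanAdj n a 19 :=
  Or.inl (Or.inr (Or.inr (Or.inr (Or.inr ⟨h, h', rfl⟩))))

/-- A list of length n - 1 that contains the n - 1 vertices other than v has no repetition and no
further entry, so neither needs to be checked. -/
theorem isTraceable_induce_of_list {n : ℕ} {v : Fin n} (l : List ℕ) (hn : 2 ≤ n)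
    (hlen : l.length + 1 = n) (hmem : ∀ x < n, x ≠ v → x ∈ l) (hl : l.IsChain (FanAdj n)) :
    ((fanGraph n).induce ({v}ᶜ : Set (Fin n))).IsTraceable := by
  have hsub : (Finset.range n).erase v ⊆ l.toFinset := by
    intro x hx
    rw [Finset.mem_erase, Finset.mem_range] at hx
    exact List.mem_toFinset.2 (hmem x hx.2 hx.1)
  have hcard : ((Finset.range n).erase (v : ℕ)).card + 1 = n := by
    rw [Finset.card_erase_add_one (Finset.mem_range.2 v.2), Finset.card_range]
  have heq := Finset.eq_of_subset_of_card_le hsub (by have := l.toFinset_card_le; omega)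
  have hnodup : l.Nodup := by
    have : (l : Multiset ℕ).toFinset.card = Multiset.card (l : Multiset ℕ) := by
      rw [Multiset.coe_card]
      change l.toFinset.card = _
      rw [← heq]
      omega
    exact Multiset.coe_nodup.1 (Multiset.toFinset_card_eq_card_iff_nodup.1 this)
  have hl' : ∀ a ∈ l, a < n ∧ a ≠ v := by
    intro a ha
    rw [← List.mem_toFinset, ← heq, Finset.mem_erase, Finset.mem_range] at ha
    exact ha.symm
  let f : ∀ a, (a < n ∧ a ≠ v) → ({v}ᶜ : Set (Fin n)) :=
    fun a h ↦ ⟨⟨a, h.1⟩, fun h' ↦ h.2 (congrArg Fin.val h')⟩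
  have hc : (l.pmap f hl').IsChain ((fanGraph n).induce ({v}ᶜ : Set (Fin n))).Adj := by
    refine List.isChain_pmap_of_isChain (fun a b ha hb h ↦ ?_) hl hl'
    exact fanGraph_adj.2 h
  have hne : l.pmap f hl' ≠ [] := by
    intro h
    have := congrArg List.length h
    rw [List.length_pmap, List.length_nil] at this
    omega
  refine ⟨_, _, Walk.ofSupport _ hne hc, ?_⟩
  refine (Walk.IsPath.isHamiltonian_iff ?_).2 ?_
  · rw [Walk.isPath_def, Walk.support_ofSupport]
    exact hnodup.pmap fun a _ b _ h ↦
      congrArg (fun x : ({v}ᶜ : Set (Fin n)) ↦ ((x : Fin n) : ℕ)) h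
  · intro w
    rw [Walk.support_ofSupport, List.mem_pmap]
    refine ⟨(w : Fin n), hmem _ w.1.2 fun h ↦ w.2 (Fin.ext h), rfl⟩

theorem isChain_rim_block {n s m : ℕ} {p q : List ℕ} (hp : p.IsChain (FanAdj n))
    (hq : q.IsChain (FanAdj n)) (hs : 20 ≤ s) (hm : 0 < m)
    (h1 : ∀ x ∈ p.getLast?, FanAdj n x s) (h2 : ∀ y ∈ q.head?, FanAdj n (s + m - 1) y) :
    (p ++ List.range' s m ++ q).IsChain (FanAdj n) := by
  have hr : (List.range' s m).IsChain (FanAdj n) := by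
    refine (List.isChain_range' s m 1).imp_of_mem_imp ?_
    rintro a b ha - rfl
    rw [List.mem_range'_1] at ha
    exact fanAdj_succ (hs.trans ha.1)
  rw [List.isChain_append, List.isChain_append]
  refine ⟨⟨hp, hr, fun x hx y hy ↦ ?_⟩, hq, fun x hx y hy ↦ ?_⟩
  · rw [List.head?_range', if_neg hm.ne', Option.mem_some_iff] at hy
    exact hy ▸ h1 x hx
  · rw [List.getLast?_append, List.getLast?_range', if_neg hm.ne', Option.some_or,
      Option.mem_some_iff] at hx
    exact hx ▸ h2 y hy

theorem isChain_fanAdj {n : ℕ} {l : List ℕ} (h : l.IsChain CoreAdj) : l.IsChain (FanAdj n) :=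
  h.imp fun _ _ ↦ CoreAdj.fanAdj

/-- For each vertex `v` outside the rim, two paths that avoid `v` and cover the other vertices
outside the rim; the rim fits between them. -/
def rimPaths : List (List ℕ × List ℕ) :=
  [([7, 5, 8, 1, 16, 6, 4, 14, 9, 15, 12, 13, 2, 10, 17, 11, 18],
      [19, 3]),
    ([7, 5, 8, 0, 16, 6, 4, 14, 9, 15, 12, 13, 2, 10, 17, 11, 18],
      [19, 3]),
    ([4, 14, 9, 15, 12, 13, 6, 7, 1, 16, 0, 8, 5, 10, 17, 11, 18],
      [19, 3]),
    ([0, 8, 1, 7, 5, 10, 17, 9, 14, 4, 15, 12, 11, 18],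
      [19, 2, 13, 6, 16]),
    ([0, 8, 1, 16, 6, 7, 5, 14, 9, 15, 12, 13, 2, 10, 17, 11, 18],
      [19, 3]),
    ([7, 1, 8, 0, 16, 6, 4, 14, 9, 15, 12, 13, 2, 10, 17, 11, 18],
      [19, 3]),
    ([7, 1, 16, 0, 8, 5, 10, 2, 13, 12, 15, 4, 14, 9, 17, 11, 18],
      [19, 3]),
    ([0, 2, 10, 5, 8, 1, 16, 6, 13, 12, 15, 4, 14, 9, 17, 11, 18],
      [19, 3]),
    ([0, 2, 10, 5, 7, 1, 16, 6, 13, 12, 15, 4, 14, 9, 17, 11, 18],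
      [19, 3]),
    ([0, 8, 1, 16, 6, 7, 5, 14, 4, 15, 12, 13, 2, 10, 17, 11, 18],
      [19, 3]),
    ([0, 8, 1, 7, 5, 14, 4, 15, 9, 17, 11, 12, 3, 18],
      [19, 2, 13, 6, 16]),
    ([0, 8, 1, 7, 5, 10, 17, 9, 14, 4, 15, 12, 3, 18],
      [19, 2, 13, 6, 16]),
    ([4, 15, 9, 14, 5, 7, 1, 8, 0, 16, 6, 13, 2, 10, 17, 11, 18],
      [19, 3]),
    ([0, 2, 10, 17, 11, 18],
      [19, 3, 12, 15, 9, 14, 4, 6, 7, 5, 8, 1, 16]),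
    ([0, 8, 1, 16, 6, 4, 15, 9, 17, 11, 18],
      [19, 3, 12, 13, 2, 10, 5, 7]),
    ([0, 8, 1, 16, 6, 4, 14, 9, 17, 11, 18],
      [19, 3, 12, 13, 2, 10, 5, 7]),
    ([0, 2, 10, 5, 8, 1, 7, 6, 13, 12, 15, 4, 14, 9, 17, 11, 18],
      [19, 3]),
    ([7, 1, 8, 0, 16, 6, 4, 15, 9, 14, 5, 10, 2, 13, 12, 11, 18],
      [19, 3]),
    ([4, 15, 9, 14, 5, 7, 1, 8, 0, 16, 6, 13, 2, 10, 17],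
      [19, 3, 12, 11]),
    ([4, 15, 9, 14, 5, 7, 1, 8, 0, 16, 6, 13, 2, 10, 17, 11, 12, 3, 18],
      [])]

/-- The properties of the entries of `rimPaths`. -/
def IsRimPath (v : ℕ) (w : List ℕ × List ℕ) : Prop :=
  w.1.IsChain CoreAdj ∧ w.2.IsChain CoreAdj ∧
    (w.1.getLast? = some 17 ∨ w.1.getLast? = some 18) ∧
    (w.2.head? = none ∨ w.2.head? = some 19) ∧ w.1.length + w.2.length = 19 ∧
    ∀ x < 20, x ≠ v → x ∈ w.1 ∨ x ∈ w.2

instance (v : ℕ) (w : List ℕ × List ℕ) : Decidable (IsRimPath v w) := by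
  unfold IsRimPath; infer_instance

theorem exists_isRimPath : ∀ v < 20, ∃ w ∈ rimPaths, IsRimPath v w := by
  decide +kernel

theorem isTraceable_delete_core {n : ℕ} (hn : 21 ≤ n) (v : Fin n) (hv : (v : ℕ) < 20) :
    ((fanGraph n).induce ({v}ᶜ : Set (Fin n))).IsTraceable := by
  obtain ⟨⟨p, q⟩, -, hp, hq, hl, hh, hlen, hmem⟩ := exists_isRimPath v hv
  dsimp only at hp hq hl hh hlen hmem
  refine isTraceable_induce_of_list (p ++ List.range' 20 (n - 20) ++ q) (by omega) ?_ ?_ ?_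
  · rw [List.length_append, List.length_append, List.length_range']
    omega
  · intro x hx hxv
    rw [List.mem_append, List.mem_append, List.mem_range'_1]
    rcases lt_or_ge x 20 with h | h
    · exact (hmem x h hxv).imp_left Or.inl
    · exact Or.inl (Or.inr ⟨h, by omega⟩)
  · refine isChain_rim_block (isChain_fanAdj hp) (isChain_fanAdj hq) le_rfl (by omega) ?_ ?_
    · intro x hx
      rw [Option.mem_def] at hx
      rcases hl with hl | hl <;> obtain rfl : _ = x := Option.some.inj (hl ▸ hx)
      · exact fanAdj_first n
      · exact fanAdj_hub le_rfl
    · intro y hy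
      rw [Option.mem_def] at hy
      rcases hh with hh | hh
      -- Here the second path is empty, and the spanning path ends on the rim.
      · cases hh ▸ hy
      · obtain rfl : _ = y := Option.some.inj (hh ▸ hy)
        exact fanAdj_last (by omega) (by omega)

theorem isTraceable_delete_rim {n : ℕ} (hn : 21 ≤ n) (v : Fin n) (hv : 20 ≤ (v : ℕ)) :
    ((fanGraph n).induce ({v}ᶜ : Set (Fin n))).IsTraceable := by
  have hvn := v.2
  have mem : ∀ p : List ℕ, (∀ x < 20, x ∈ p) → ∀ x, x ∈ p ∨ 20 ≤ x := by
    intro p h x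
    rcases lt_or_ge x 20 with h' | h'
    · exact Or.inl (h x h')
    · exact Or.inr h'
  rcases hv.eq_or_lt with h20 | h20 <;> rcases (show (v : ℕ) + 1 ≤ n by omega).eq_or_lt with hl | hl
  -- The rim consists of v alone, and the core itself has a spanning path.
  · refine isTraceable_induce_of_list
      [0, 8, 1, 7, 5, 10, 2, 19, 3, 18, 11, 17, 9, 14, 4, 15, 12, 13, 6, 16] (by omega) ?_ ?_ ?_
    · rw [← hl, ← h20]; rfl
    · intro x hx hxv
      refine (mem _ (by decide) x).resolve_right (by omega)
    · exact isChain_fanAdj (by decide)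
  -- The first rim vertex is missing: the rim is entered from the hub and left to 19.
  · refine isTraceable_induce_of_list
      ([0, 8, 1, 16, 6, 7, 5, 10, 2, 13, 12, 15, 4, 14, 9, 17, 11, 18] ++
        List.range' 21 (n - 21) ++ [19, 3]) (by omega) ?_ ?_ ?_
    · simp
      omega
    · intro x hx hxv
      rw [List.mem_append, List.mem_append, List.mem_range'_1]
      have := mem ([0, 8, 1, 16, 6, 7, 5, 10, 2, 13, 12, 15, 4, 14, 9, 17, 11, 18] ++ [19, 3])
        (by decide) x
      rw [List.mem_append] at this
      rcases this with (h | h) | h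
      · exact Or.inl (Or.inl h)
      · exact Or.inr h
      · exact Or.inl (Or.inr (by omega))
    · refine isChain_rim_block (isChain_fanAdj (by decide)) (isChain_fanAdj (by decide))
        (by omega) (by omega) ?_ ?_
      · rintro x ⟨⟩
        exact fanAdj_hub (by omega)
      · rintro x ⟨⟩
        exact fanAdj_last (by omega) (by omega)
  -- The last rim vertex is missing: the path ends on the rim.
  · refine isTraceable_induce_of_list
      ([3, 19, 2, 10, 5, 7, 1, 8, 0, 16, 6, 13, 12, 15, 4, 14, 9, 17, 11, 18] ++
        List.range' 20 (n - 21) ++ []) (by omega) ?_ ?_ ?_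
    · simp
      omega
    · intro x hx hxv
      rw [List.mem_append, List.mem_append, List.mem_range'_1]
      have := mem [3, 19, 2, 10, 5, 7, 1, 8, 0, 16, 6, 13, 12, 15, 4, 14, 9, 17, 11, 18]
        (by decide) x
      rcases this with h | h
      · exact Or.inl (Or.inl h)
      · exact Or.inl (Or.inr (by omega))
    · refine isChain_rim_block (isChain_fanAdj (by decide)) (isChain_fanAdj (by decide))
        (by omega) (by omega) ?_ ?_
      · rintro x ⟨⟩
        exact fanAdj_hub (by omega)
      · rintro x ⟨⟩
  -- An inner rim vertex is missing: the hub bridges the gap between the two pieces of the rim.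
  · refine isTraceable_induce_of_list
      (([4, 15, 9, 14, 5, 7, 1, 8, 0, 16, 6, 13, 2, 10, 17] ++ List.range' 20 (v - 20) ++ [18]) ++
        List.range' (v + 1) (n - (v + 1)) ++ [19, 3, 12, 11]) (by omega) ?_ ?_ ?_
    · simp
      omega
    · intro x hx hxv
      simp only [List.mem_append, List.mem_range'_1]
      have := mem ([4, 15, 9, 14, 5, 7, 1, 8, 0, 16, 6, 13, 2, 10, 17] ++ [18] ++ [19, 3, 12, 11])
        (by decide) x
      rw [List.mem_append, List.mem_append] at this
      rcases this with ((h | h) | h) | h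
      · exact Or.inl (Or.inl (Or.inl (Or.inl h)))
      · exact Or.inl (Or.inl (Or.inr h))
      · exact Or.inr h
      · rcases lt_or_gt_of_ne hxv with h' | h'
        · exact Or.inl (Or.inl (Or.inl (Or.inr (by omega))))
        · exact Or.inl (Or.inr (by omega))
    · refine isChain_rim_block (isChain_rim_block (isChain_fanAdj (by decide))
        (isChain_fanAdj (by decide)) (by omega) (by omega) ?_ ?_) (isChain_fanAdj (by decide))
        (by omega) (by omega) ?_ ?_
      · rintro x ⟨⟩
        exact fanAdj_first n
      · rintro x ⟨⟩
        exact (fanAdj_hub (by omega)).symm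
      · intro x hx
        rw [List.getLast?_concat, Option.mem_some_iff] at hx
        exact hx ▸ fanAdj_hub (by omega)
      · rintro x ⟨⟩
        exact fanAdj_last (by omega) (by omega)

theorem fanGraph_isTraceable_delete {n : ℕ} (hn : 21 ≤ n) (v : Fin n) :
    ((fanGraph n).induce ({v}ᶜ : Set (Fin n))).IsTraceable := by
  rcases lt_or_ge (v : ℕ) 20 with h | h
  · exact isTraceable_delete_core hn v h
  · exact isTraceable_delete_rim hn v h

/-! ### 3-connectedness. -/

/-- The set of vertices, encoded as a bit mask, that grows out of `R` by walking along the edges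
in the list. -/
def grow : List (ℕ × ℕ) → ℕ → ℕ
  | [], R => R
  | (a, b) :: L, R => grow L (if R.testBit a || R.testBit b then R ||| (2 ^ a ||| 2 ^ b) else R)

theorem grow_sound {f : ℕ → Prop} {c : Prop} {L : List (ℕ × ℕ)} (hL : ∀ e ∈ L, f e.1 ↔ f e.2)
    {R : ℕ} (hR : ∀ i, R.testBit i → (f i ↔ c)) : ∀ i, (grow L R).testBit i → (f i ↔ c) := by
  induction L generalizing R with
  | nil => exact hR
  | cons e L ih =>
    obtain ⟨a, b⟩ := e
    refine ih (fun e he ↦ hL e (List.mem_cons_of_mem _ he)) ?_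
    have hab : f a ↔ f b := hL (a, b) List.mem_cons_self
    intro i hi
    split_ifs at hi with h
    · rw [Bool.or_eq_true] at h
      have hc : f a ↔ c := h.elim (hR a) fun h ↦ hab.trans (hR b h)
      rw [Nat.testBit_or, Nat.testBit_or, Nat.testBit_two_pow, Nat.testBit_two_pow,
        Bool.or_eq_true, Bool.or_eq_true, decide_eq_true_iff, decide_eq_true_iff] at hi
      rcases hi with hi | rfl | rfl
      · exact hR i hi
      · exact hc
      · exact hab.symm.trans hc
    · exact hR i hi

/-- The edges in the list that avoid `s` and `t`. -/
def avoiding (L : List (ℕ × ℕ)) (s t : ℕ) : List (ℕ × ℕ) :=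
  L.filter fun e ↦ e.1 ≠ s ∧ e.1 ≠ t ∧ e.2 ≠ s ∧ e.2 ≠ t

/-- The graph on `0, …, N - 1` with the given edges is seen to be connected after the removal of
`s` and `t`. -/
def IsConnectedAvoiding (L : List (ℕ × ℕ)) (N s t : ℕ) : Prop :=
  -- One of 0, 1, 2 survives the deletion of two vertices. The six passes over the edges only have
  -- to suffice for the check to succeed; soundness does not depend on their number.
  ∃ r < 3, ∀ x < N, x = s ∨ x = t ∨
    (grow (avoiding L s t ++ avoiding L s t ++ avoiding L s t ++ avoiding L s t ++
      avoiding L s t ++ avoiding L s t) (2 ^ r)).testBit x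

instance (L : List (ℕ × ℕ)) (N s t : ℕ) : Decidable (IsConnectedAvoiding L N s t) := by
  unfold IsConnectedAvoiding; infer_instance

theorem IsConnectedAvoiding.exists_iff {L : List (ℕ × ℕ)} {N s t : ℕ}
    (h : IsConnectedAvoiding L N s t) {f : ℕ → Prop}
    (hf : ∀ e ∈ L, e.1 ≠ s → e.1 ≠ t → e.2 ≠ s → e.2 ≠ t → (f e.1 ↔ f e.2)) :
    ∃ c, ∀ x < N, x ≠ s → x ≠ t → (f x ↔ c) := by
  obtain ⟨r, -, h⟩ := h
  refine ⟨f r, fun x hx hs ht ↦ ?_⟩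
  refine grow_sound ?_ ?_ x (((h x hx).resolve_left hs).resolve_left ht)
  · intro e he
    have he : e ∈ avoiding L s t := by simpa using he
    rw [avoiding, List.mem_filter, decide_eq_true_iff] at he
    exact hf e he.1 he.2.1 he.2.2.1 he.2.2.2.1 he.2.2.2.2
  · intro i hi
    rw [Nat.testBit_two_pow, decide_eq_true_iff] at hi
    rw [hi]

/-- The edges of the graph in which the rim is contracted to the vertex `20`. -/
def contractedEdges : List (ℕ × ℕ) := coreEdges ++ [(17, 20), (18, 20), (19, 20)]

/-- The value 21 is no vertex and stands for an idle deletion; in `coreEdges_isConnectedAvoiding`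
the value 20 has this role. -/
theorem contractedEdges_isConnectedAvoiding : ∀ s < 22, ∀ t < 22,
    IsConnectedAvoiding contractedEdges 21 s t := by
  decide +kernel

theorem coreEdges_isConnectedAvoiding : ∀ s < 21, IsConnectedAvoiding coreEdges 20 s s := by
  decide +kernel

theorem iff_up {s t : ℕ} {n : ℕ} {f : ℕ → Prop}
    (hf : ∀ a b, a < n → b < n → FanAdj n a b → a ≠ s → a ≠ t → b ≠ s → b ≠ t → (f a ↔ f b))
    {x y : ℕ} (hx : 20 ≤ x) (hxy : x ≤ y) (hy : y < n)
    (h : ∀ z, x ≤ z → z ≤ y → z ≠ s ∧ z ≠ t) : f x ↔ f y := by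
  induction y, hxy using Nat.le_induction with
  | base => exact Iff.rfl
  | succ y hxy ih =>
    have h1 := h y hxy (by omega)
    have h2 := h (y + 1) (by omega) le_rfl
    exact (ih (by omega) fun z h' h'' ↦ h z h' (by omega)).trans
      (hf _ _ (by omega) hy (fanAdj_succ (hx.trans hxy)) h1.1 h1.2 h2.1 h2.2)

/-- The core stays connected after the loss of t. Each remaining rim vertex is attached to it by its
spoke or, if t is the hub, along the rim to 17 or 19, on the side away from s. -/
theorem exists_iff_of_fanAdj_rim {n s t : ℕ} {f : ℕ → Prop}
    (hf : ∀ a b, a < n → b < n → FanAdj n a b → a ≠ s → a ≠ t → b ≠ s → b ≠ t → (f a ↔ f b))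
    (hs : 20 ≤ s) (hsn : s < n) : ∃ c, ∀ x < n, x ≠ s → x ≠ t → (f x ↔ c) := by
  obtain ⟨c, hc⟩ := (coreEdges_isConnectedAvoiding (min t 20) (by omega)).exists_iff (f := f) (by
      intro e he h1 h2 h3 h4
      have := lt_of_mem_coreEdges (a := e.1) (b := e.2) he
      exact hf _ _ (by omega) (by omega) (Or.inl (Or.inl he)) (by omega) (by omega) (by omega)
        (by omega))
  refine ⟨c, fun x hx hxs hxt ↦ ?_⟩
  rcases lt_or_ge x 20 with h | h
  · exact hc x (by omega) (by omega) (by omega)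
  by_cases ht : t = 18
  · rcases lt_or_gt_of_ne hxs with h' | h'
    · rw [← iff_up hf le_rfl h hx (fun z _ _ ↦ by omega),
        ← hf 17 20 (by omega) (by omega) (fanAdj_first n) (by omega) (by omega) (by omega)
          (by omega)]
      exact hc 17 (by omega) (by omega) (by omega)
    · rw [iff_up hf h (show x ≤ n - 1 by omega) (by omega) (fun z _ _ ↦ by omega),
        hf (n - 1) 19 (by omega) (by omega) (fanAdj_last (by omega) (by omega)) (by omega)
          (by omega) (by omega) (by omega)]
      exact hc 19 (by omega) (by omega) (by omega)
  · rw [← hf 18 x (by omega) hx (fanAdj_hub h) (by omega) (by omega) hxs hxt]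
    exact hc 18 (by omega) (by omega) (by omega)

/-- A property that is constant along the edges avoiding `s` and `t` is constant. -/
theorem exists_iff_of_fanAdj {n s t : ℕ} (hn : 21 ≤ n) {f : ℕ → Prop}
    (hf : ∀ a b, a < n → b < n → FanAdj n a b → a ≠ s → a ≠ t → b ≠ s → b ≠ t → (f a ↔ f b)) :
    ∃ c, ∀ x < n, x ≠ s → x ≠ t → (f x ↔ c) := by
  by_cases hs : 20 ≤ s ∧ s < n
  · exact exists_iff_of_fanAdj_rim hf hs.1 hs.2
  by_cases ht : 20 ≤ t ∧ t < n
  · obtain ⟨c, hc⟩ := exists_iff_of_fanAdj_rim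
      (fun a b ha hb h h1 h2 h3 h4 ↦ hf a b ha hb h h2 h1 h4 h3) ht.1 ht.2
    exact ⟨c, fun x hx hs ht ↦ hc x hx ht hs⟩
  obtain ⟨c, hc⟩ := (contractedEdges_isConnectedAvoiding (min s 21) (by omega) (min t 21)
    (by omega)).exists_iff (f := f) (by
      intro e he h1 h2 h3 h4
      rw [contractedEdges, List.mem_append, List.mem_cons, List.mem_cons, List.mem_singleton] at he
      rcases he with he | rfl | rfl | rfl
      · have := lt_of_mem_coreEdges (a := e.1) (b := e.2) he
        exact hf _ _ (by omega) (by omega) (Or.inl (Or.inl he)) (by omega) (by omega) (by omega)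
          (by omega)
      · exact hf _ _ (by omega) (by omega) (fanAdj_first n) (by omega) (by omega) (by omega)
          (by omega)
      · exact hf _ _ (by omega) (by omega) (fanAdj_hub le_rfl) (by omega) (by omega) (by omega)
          (by omega)
      · refine (hf _ _ (by omega) (by omega)
          (fanAdj_last (a := n - 1) (by omega) (by omega)).symm (by omega) (by omega) (by omega)
          (by omega)).trans ?_
        exact (iff_up hf le_rfl (by omega) (by omega) fun z _ _ ↦ by omega).symm)
  refine ⟨c, fun x hx hxs hxt ↦ ?_⟩
  rcases lt_or_ge x 20 with h | h
  · exact hc x (by omega) (by omega) (by omega)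
  · rw [← iff_up hf le_rfl h hx fun z _ _ ↦ by omega]
    exact hc 20 (by omega) (by omega) (by omega)

theorem exists_pair_of_card_lt_three {n : ℕ} {S : Finset (Fin n)} (hS : S.card < 3) :
    ∃ s t : ℕ, ∀ x : Fin n, x ∈ S ↔ (x : ℕ) = s ∨ (x : ℕ) = t := by
  rcases (show S.card = 0 ∨ S.card = 1 ∨ S.card = 2 by omega) with h | h | h
  · rw [Finset.card_eq_zero] at h
    exact ⟨n, n, fun x ↦ by simp [h, x.2.ne]⟩
  · obtain ⟨a, rfl⟩ := Finset.card_eq_one.1 h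
    exact ⟨a, a, fun x ↦ by simp [Fin.ext_iff]⟩
  · obtain ⟨a, b, -, rfl⟩ := Finset.card_eq_two.1 h
    exact ⟨a, b, fun x ↦ by simp [Fin.ext_iff]⟩

theorem fanGraph_isKConnected {n : ℕ} (hn : 21 ≤ n) : (fanGraph n).IsKConnected 3 := by
  refine ⟨by rw [Fintype.card_fin]; omega, fun S hS ↦ ?_⟩
  obtain ⟨s, t, hst⟩ := exists_pair_of_card_lt_three hS
  have hne : Nonempty ((S : Set (Fin n))ᶜ : Set (Fin n)) := by
    obtain ⟨x, hx⟩ : ∃ x, x ∉ S := by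
      by_contra! h
      have := Finset.card_le_card (show Finset.univ ⊆ S from fun x _ ↦ h x)
      rw [Finset.card_univ, Fintype.card_fin] at this
      omega
    exact ⟨⟨x, hx⟩⟩
  refine (connected_iff _).2 ⟨fun u v ↦ ?_, hne⟩
  have mem : ∀ x : Fin n, (x : ℕ) ≠ s → (x : ℕ) ≠ t → x ∈ ((S : Set (Fin n))ᶜ : Set (Fin n)) :=
    fun x h h' hx ↦ ((hst x).1 hx).elim h h'
  -- The property is reachability from u; it holds at u, hence at v.
  obtain ⟨c, hc⟩ := exists_iff_of_fanAdj (s := s) (t := t) hn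
    (f := fun x ↦ ∃ (h : x < n) (h' : (⟨x, h⟩ : Fin n) ∈ ((S : Set (Fin n))ᶜ : Set (Fin n))),
      ((fanGraph n).induce ((S : Set (Fin n))ᶜ)).Reachable u ⟨⟨x, h⟩, h'⟩) (by
    intro a b ha hb hab has hat hbs hbt
    have adj : ((fanGraph n).induce ((S : Set (Fin n))ᶜ)).Adj ⟨⟨a, ha⟩, mem _ has hat⟩
        ⟨⟨b, hb⟩, mem _ hbs hbt⟩ := fanGraph_adj.2 hab
    exact ⟨fun ⟨_, _, h⟩ ↦ ⟨hb, _, h.trans adj.reachable⟩,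
      fun ⟨_, _, h⟩ ↦ ⟨ha, _, h.trans adj.symm.reachable⟩⟩)
  have ne : ∀ x : ((S : Set (Fin n))ᶜ : Set (Fin n)),
      ((x : Fin n) : ℕ) ≠ s ∧ ((x : Fin n) : ℕ) ≠ t :=
    fun x ↦ ⟨fun h ↦ x.2 ((hst x).2 (Or.inl h)), fun h ↦ x.2 ((hst x).2 (Or.inr h))⟩
  have hu := (hc u u.1.2 (ne u).1 (ne u).2).1 ⟨u.1.2, u.2, Reachable.refl u⟩
  obtain ⟨_, _, h⟩ := (hc v v.1.2 (ne v).1 (ne v).2).2 hu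
  exact h

/-! ### Non-hamiltonicity. -/

/-- The number of edges in the list that are incident with `w`. -/
def edgeDegree (L : List (ℕ × ℕ)) (w : ℕ) : ℕ := L.countP fun e ↦ e.1 == w || e.2 == w

/-- A lower bound for the degree in a contracted spanning cycle. -/
def degreeBound (w : ℕ) : ℕ := if w < 20 then if w = 18 then 1 else 2 else 0

/-- The vertices `0, …, 20` with the given edges are seen to form a disconnected graph. -/
def isDisconnected (L : List (ℕ × ℕ)) : Bool :=
  let R := grow (L ++ L ++ L ++ L ++ L ++ L ++ L ++ L ++ L ++ L) 1
  (L.all fun e ↦ R.testBit e.1 == R.testBit e.2) && (List.range 21).any fun v ↦ !R.testBit v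

/-- A search through all extensions of the edge set `X` by edges in the list, for a contracted
spanning cycle; the value is `true` if there is none. -/
def searchFails : List (ℕ × ℕ) → List (ℕ × ℕ) → Bool
  | [], X => isDisconnected X
  | e :: L, X =>
    ((e.1 < 20 && 2 < edgeDegree (e :: X) e.1) || (e.2 < 20 && 2 < edgeDegree (e :: X) e.2) ||
      searchFails L (e :: X)) &&
    (edgeDegree X e.1 + edgeDegree L e.1 < degreeBound e.1 ||
      edgeDegree X e.2 + edgeDegree L e.2 < degreeBound e.2 || searchFails L X)

theorem searchFails_contractedEdges : searchFails contractedEdges [] = true := by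
  decide +kernel

/-- `isDisconnected` also tests that the grown set is closed under the edges. Its indicator function
is then constant along edges but not constant, however many passes were made. -/
theorem not_isDisconnected {X : List (ℕ × ℕ)}
    (h : ∀ f : ℕ → Bool, (∀ e ∈ X, f e.1 = f e.2) → ∀ a < 21, f a = f 0) :
    isDisconnected X = false := by
  rw [← Bool.not_eq_true]
  intro h'
  rw [isDisconnected, Bool.and_eq_true, List.all_eq_true, List.any_eq_true] at h'
  obtain ⟨h1, v, hv, h2⟩ := h'
  have h3 := h _ (fun e he ↦ eq_of_beq (h1 e he)) v (List.mem_range.1 hv)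
  have h4 : ∀ L : List (ℕ × ℕ), ∀ R, R.testBit 0 = true → (grow L R).testBit 0 = true := by
    intro L
    induction L with
    | nil => exact fun R h ↦ h
    | cons e L ih =>
      refine fun R h ↦ ih _ ?_
      split_ifs
      · rw [Nat.testBit_or, h, Bool.true_or]
      · exact h
  rw [h4 _ _ (by decide)] at h3
  rw [h3] at h2
  exact absurd h2 (by decide)

theorem edgeDegree_cons (e : ℕ × ℕ) (L : List (ℕ × ℕ)) (w : ℕ) :
    edgeDegree (e :: L) w = edgeDegree L w + edgeDegree [e] w := by
  rw [edgeDegree, edgeDegree, edgeDegree, ← List.countP_append, List.countP_append, Nat.add_comm,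
    ← List.countP_append, List.singleton_append]

theorem edgeDegree_filter_le (x : ℕ × ℕ → Bool) (L : List (ℕ × ℕ)) (w : ℕ) :
    edgeDegree (L.filter x) w ≤ edgeDegree L w :=
  List.filter_sublist.countP_le

/-- If the search fails, then no set of edges `x` that extends `X` has the degrees of a contracted
spanning cycle and is connected. -/
theorem searchFails_eq_false {L X : List (ℕ × ℕ)} {x : ℕ × ℕ → Bool}
    (hle : ∀ w < 20, edgeDegree X w + edgeDegree (L.filter x) w ≤ 2)
    (hge : ∀ w, degreeBound w ≤ edgeDegree X w + edgeDegree (L.filter x) w)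
    (hX : ∀ f : ℕ → Bool, (∀ e ∈ X, f e.1 = f e.2) → (∀ e ∈ L.filter x, f e.1 = f e.2) →
      ∀ a < 21, f a = f 0) : searchFails L X = false := by
  induction L generalizing X with
  | nil => exact not_isDisconnected fun f hf ↦ hX f hf (by simp)
  | cons e L ih =>
    rw [searchFails, Bool.and_eq_false_iff]
    -- The set x selects the branch of the search to follow; its degrees rule out pruning on that
    -- branch.
    by_cases hx : x e = true
    · left
      rw [List.filter_cons_of_pos hx] at hle hge hX
      have hle' : ∀ w < 20, edgeDegree (e :: X) w + edgeDegree (L.filter x) w ≤ 2 := by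
        intro w hw
        have := hle w hw
        rw [edgeDegree_cons] at this ⊢
        omega
      simp only [Bool.or_eq_false_iff, Bool.and_eq_false_iff, decide_eq_false_iff_not]
      refine ⟨⟨?_, ?_⟩, ih hle' ?_ ?_⟩
      · by_cases h : e.1 < 20
        · have := hle' _ h
          omega
        · exact Or.inl h
      · by_cases h : e.2 < 20
        · have := hle' _ h
          omega
        · exact Or.inl h
      · intro w
        have := hge w
        rw [edgeDegree_cons] at this ⊢
        omega
      · intro f hf hf'
        rw [List.forall_mem_cons] at hf
        exact hX f hf.2 (List.forall_mem_cons.2 ⟨hf.1, hf'⟩)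
    · right
      rw [List.filter_cons_of_neg hx] at hle hge hX
      simp only [Bool.or_eq_false_iff, decide_eq_false_iff_not, not_lt]
      exact ⟨⟨(hge _).trans (Nat.add_le_add_left (edgeDegree_filter_le x L _) _),
        (hge _).trans (Nat.add_le_add_left (edgeDegree_filter_le x L _) _)⟩, ih hle hge hX⟩

/-- The image of the edge between `a` and `b` when the rim is contracted to `20`. -/
def contractEdge (a b : ℕ) : ℕ × ℕ := (min (min a b) 20, min (max a b) 20)

theorem FanRel.contractEdge_mem {n a b : ℕ} (h : FanRel n a b) (h' : a < 20 ∨ b < 20) :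
    contractEdge a b ∈ contractedEdges := by
  have key : ∀ c d, (c, d) ∈ contractedEdges → min (min a b) 20 = c → min (max a b) 20 = d →
      contractEdge a b ∈ contractedEdges := by
    rintro c d h rfl rfl
    exact h
  rcases h with h | ⟨rfl, rfl⟩ | ⟨rfl, h⟩ | ⟨h, rfl⟩ | ⟨h, -, rfl⟩
  · have := lt_of_mem_coreEdges h
    exact key a b (List.mem_append_left _ h) (by omega) (by omega)
  · exact key 17 20 (by decide) (by omega) (by omega)
  · exact key 18 20 (by decide) (by omega) (by omega)
  · omega
  · exact key 19 20 (by decide) (by omega) (by omega)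

theorem contractEdge_comm (a b : ℕ) : contractEdge a b = contractEdge b a := by
  rw [contractEdge, contractEdge, min_comm a, max_comm a]

theorem FanAdj.contractEdge_mem {n a b : ℕ} (h : FanAdj n a b) (h' : a < 20 ∨ b < 20) :
    contractEdge a b ∈ contractedEdges := by
  rcases h with h | h
  · exact h.contractEdge_mem h'
  · exact contractEdge_comm a b ▸ h.contractEdge_mem h'.symm

theorem FanAdj.eq_of_rim {n v w : ℕ} (h : FanAdj n v w) (hv : v < 20) (hv' : v ≠ 18)
    (hw : 20 ≤ w) : v = 17 ∧ w = 20 ∨ v = 19 ∧ w + 1 = n := by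
  rcases h with (h | h | h | h | h) | (h | h | h | h | h)
  · have := lt_of_mem_coreEdges h; omega
  · omega
  · omega
  · omega
  · omega
  · have := lt_of_mem_coreEdges h; omega
  all_goals omega

theorem contractEdge_inj {v w w' : ℕ} (h : contractEdge v w = contractEdge v w') (hv : v < 20) :
    min w 20 = min w' 20 := by
  rw [contractEdge, contractEdge, Prod.mk.injEq] at h
  omega

/-- The contraction of the edges of a subgraph. -/
def contractedEdgeSet {n : ℕ} (H : (fanGraph n).Subgraph) : Set (ℕ × ℕ) :=
  {e | ∃ a b : Fin n, H.Adj a b ∧ e = contractEdge a b}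

open Classical in
/-- The contraction of the edges of a subgraph, as a list. -/
noncomputable def contractedEdgeList {n : ℕ} (H : (fanGraph n).Subgraph) : List (ℕ × ℕ) :=
  contractedEdges.filter fun e ↦ e ∈ contractedEdgeSet H

theorem mem_contractedEdgeList {n : ℕ} {H : (fanGraph n).Subgraph} {e : ℕ × ℕ} :
    e ∈ contractedEdgeList H ↔ e ∈ contractedEdges ∧ e ∈ contractedEdgeSet H := by
  simp only [contractedEdgeList, List.mem_filter, decide_eq_true_eq]

theorem Subgraph.contractEdge_mem {n : ℕ} {H : (fanGraph n).Subgraph} {a b : Fin n}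
    (h : H.Adj a b) (h' : (a : ℕ) < 20 ∨ (b : ℕ) < 20) :
    contractEdge a b ∈ contractedEdgeList H :=
  mem_contractedEdgeList.2
    ⟨FanAdj.contractEdge_mem (fanGraph_adj.1 h.adj_sub) h', a, b, h, rfl⟩

theorem edgeDegree_contractedEdgeList {n : ℕ} (H : (fanGraph n).Subgraph) (v : Fin n)
    (hv : (v : ℕ) < 20) : edgeDegree (contractedEdgeList H) v =
      ((fun w : Fin n ↦ contractEdge v w) '' H.neighborSet v).ncard := by
  have hnodup : ((contractedEdgeList H).filter fun e ↦ e.1 == (v : ℕ) || e.2 == (v : ℕ)).Nodup :=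
    ((show contractedEdges.Nodup by decide).filter _).filter _
  rw [edgeDegree, List.countP_eq_length_filter, ← List.toFinset_card_of_nodup hnodup,
    ← Set.ncard_coe_finset]
  congr 1
  ext e
  rw [Finset.mem_coe, List.mem_toFinset, List.mem_filter, Bool.or_eq_true, beq_iff_eq, beq_iff_eq]
  constructor
  · rintro ⟨he, hev⟩
    rw [mem_contractedEdgeList] at he
    obtain ⟨-, a, b, hab, rfl⟩ := he
    have hab' : a = v ∨ b = v := by
      rw [Fin.ext_iff, Fin.ext_iff]
      rw [contractEdge] at hev
      dsimp only at hev
      omega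
    rcases hab' with rfl | rfl
    · exact ⟨b, hab, rfl⟩
    · exact ⟨a, hab.symm, contractEdge_comm _ _⟩
  · rintro ⟨w, hw, rfl⟩
    refine ⟨Subgraph.contractEdge_mem hw (Or.inl hv), ?_⟩
    dsimp only [contractEdge]
    omega

/-- Only 17, 18 and 19 have rim neighbours, and 17 and 19 have just one each; hence edges can merge
only at the hub. -/
theorem injOn_contractEdge {n : ℕ} (H : (fanGraph n).Subgraph) (v : Fin n)
    (hv : (v : ℕ) < 20) (hv' : (v : ℕ) ≠ 18) :
    Set.InjOn (fun w : Fin n ↦ contractEdge v w) (H.neighborSet v) := by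
  intro w hw w' hw' h
  have h1 := contractEdge_inj h hv
  have h2 := FanAdj.eq_of_rim (fanGraph_adj.1 (H.adj_sub hw)) hv hv'
  have h3 := FanAdj.eq_of_rim (fanGraph_adj.1 (H.adj_sub hw')) hv hv'
  rw [Fin.ext_iff]
  omega

theorem Subgraph.Connected.forall_eq_of_connected {V : Type*} {G : SimpleGraph V} {H : G.Subgraph}
    (hH : H.Connected) {f : V → Bool} (hf : ∀ a b, H.Adj a b → f a = f b) {a b : V}
    (ha : a ∈ H.verts) (hb : b ∈ H.verts) : f a = f b := by
  have key : ∀ u v : H.verts, H.coe.Walk u v → f u = f v := by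
    intro u v p
    induction p with
    | nil => rfl
    | cons h _ ih => exact (hf _ _ h).trans ih
  obtain ⟨p⟩ := hH.coe.preconnected ⟨a, ha⟩ ⟨b, hb⟩
  exact key _ _ p

theorem fanGraph_not_isHamiltonian {n : ℕ} (hn : 21 ≤ n) : ¬ (fanGraph n).IsHamiltonian := by
  intro h
  have : Nontrivial (Fin n) := Fin.nontrivial_iff_two_le.2 (by omega)
  obtain ⟨p, hp⟩ := h.exists_isHamiltonianCycle ⟨0, by omega⟩
  have hdeg : ∀ v : Fin n, (p.toSubgraph.neighborSet v).ncard = 2 := fun v ↦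
    hp.isCycle.ncard_neighborSet_toSubgraph_eq_two (hp.mem_support v)
  have hverts : ∀ v : Fin n, v ∈ p.toSubgraph.verts := fun v ↦
    p.mem_verts_toSubgraph.2 (hp.mem_support v)
  have hle : ∀ w < 20, edgeDegree (contractedEdgeList p.toSubgraph) w ≤ 2 := by
    intro w hw
    rw [edgeDegree_contractedEdgeList p.toSubgraph ⟨w, by omega⟩ hw, ← hdeg ⟨w, by omega⟩]
    exact Set.ncard_image_le (Set.toFinite _)
  have hge : ∀ w, degreeBound w ≤ edgeDegree (contractedEdgeList p.toSubgraph) w := by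
    intro w
    rw [degreeBound]
    split_ifs with hw hw'
    · rw [edgeDegree_contractedEdgeList p.toSubgraph ⟨w, by omega⟩ hw]
      have hne : (p.toSubgraph.neighborSet ⟨w, by omega⟩).Nonempty := by
        rw [← Set.ncard_pos, hdeg]
        exact two_pos
      exact (Set.ncard_pos (Set.toFinite _)).2 (hne.image _)
    · rw [edgeDegree_contractedEdgeList p.toSubgraph ⟨w, by omega⟩ hw,
        (injOn_contractEdge _ ⟨w, by omega⟩ hw hw').ncard_image, hdeg]
    · exact Nat.zero_le _
  have hconn : ∀ f : ℕ → Bool, (∀ e ∈ contractedEdgeList p.toSubgraph, f e.1 = f e.2) →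
      ∀ a < 21, f a = f 0 := by
    intro f hf a ha
    -- Pulled back along the contraction, f is constant along the cycle; edges inside the rim become
    -- loops at 20.
    have := p.toSubgraph_connected.forall_eq_of_connected
      (f := fun v : Fin n ↦ f (min v 20)) ?_ (hverts ⟨a, by omega⟩) (hverts ⟨0, by omega⟩)
    · dsimp only at this
      rwa [min_eq_left (by omega), min_eq_left (by omega)] at this
    · intro a b hab
      by_cases h' : (a : ℕ) < 20 ∨ (b : ℕ) < 20
      · have := hf _ (Subgraph.contractEdge_mem hab h')
        dsimp only [contractEdge] at this
        rcases le_total (a : ℕ) b with h | h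
        · rwa [min_eq_left h, max_eq_right h] at this
        · rw [min_eq_right h, max_eq_left h] at this
          exact this.symm
      · rw [min_eq_right (by omega), min_eq_right (by omega)]
  have := searchFails_eq_false (L := contractedEdges) (X := []) (fun w hw ↦ ?_) (fun w ↦ ?_)
    (fun f _ ↦ hconn f)
  · rw [searchFails_contractedEdges] at this
    exact absurd this (by decide)
  · exact (Nat.zero_add _).trans_le (hle w hw)
  · exact (hge w).trans_eq (Nat.zero_add _).symm

theorem fanGraph_isPolyhedral {n : ℕ} (hn : 21 ≤ n) : (fanGraph n).IsPolyhedral :=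
  ⟨fanGraph_isPlanar hn, fanGraph_isKConnected hn⟩

theorem fanGraph_isPlatypus {n : ℕ} (hn : 21 ≤ n) : (fanGraph n).IsPlatypus := by
  refine ⟨?_, fanGraph_not_isHamiltonian hn, fanGraph_isTraceable_delete hn⟩
  rw [Fintype.card_fin]
  omega

end SimpleGraph

theorem mainTheorem10 (n : ℕ) (hn : 21 ≤ n) :
    ∃ G : SimpleGraph (Fin n), G.IsPolyhedral ∧ G.IsPlatypus :=
  ⟨SimpleGraph.fanGraph n, SimpleGraph.fanGraph_isPolyhedral hn,
    SimpleGraph.fanGraph_isPlatypus hn⟩
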